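/- Notation: for $n\ge 0$ let $[n]_q = 1+q+\cdots+q^{n-1}$, $[n]_q! = [n]_q[n-1]_q\cdots[1]_q$, $\binom{n}{k}_q=\frac{[n]_q!}{[k]_q!\,[n-k]_q!}$ for $0\le k\le n$. For integers $0\le i\le m$ and a rational number $y\ge 1$, the higher $q$-rational $r^q_{i,m}(y)$ is the rational function of $q$ defined recursively by: $r^q_{0,m}(y)=1$; $r^q_{i,m}(n)=\binom{n+i-1}{i}_q$ for a positive integer $n$; and, if $y=[a_1,a_2,\dots,a_n]$ (continued fraction with positive integer terms) is not an integer and $y'=[a_2,\dots,a_n]=1/(y-\lfloor y\rfloor)$, \[ r^q_{i,m}(y)=\sum_{k=0}^{i} q^{k a_1}\binom{a_1+i-k-1}{i-k}_q\,\frac{r^{q^{-1}}_{m-k,m}(y')}{r^{q^{-1}}_{m,m}(y')}, \] where $r^{q^{-1}}_{j,m}(y')$ is obtained from $r^{q}_{j,m}(y')$ by replacing $q$ with $q^{-1}$. Each $r^q_{i,m}(y)$ is expanded at $q=0$ as a formal Laurent series in $q$. A sequence of Laurent series is said to stabilize to a Laurent series $L$ if for every integer $N$ all but finitely many of its terms agree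 with $L$ in all degrees $\le N$; in particular, the coefficients of each fixed power of $q$ are eventually constant, equal to that of $L$. Theorem. Let $0\le i\le m$ be integers and let $x=[a_1,a_2,\dots]>1$ be an irrational number (all $a_j$ positive integers), with convergents $x_n=[a_1,\dots,a_n]$. There is a unique formal Laurent series with integer coefficients, denoted $r^q_{i,m}(x)$, that has no negative powers of $q$ and is such that the expansions of $r^q_{i,m}(x_n)$ stabilize to it as $n\to\infty$ and, moreover, for any sequence $y_1,y_2,\dots$ of rational numbers converging to $x$, the expansions of $r^q_{i,m}(y_n)$ (which are defined for all large $n$, since then $y_n\ge1$) stabilize to $r^q_{i,m}(x)$ as $n\to\infty$. -/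

import Mathlib

open Filter Topology

namespace HigherQ

/-- The `q`-integer `[n]_q = 1 + q + ⋯ + q ^ (n - 1)`. -/
def qInt {K : Type*} [Field K] (q : K) (n : ℕ) : K :=
  ∑ j ∈ Finset.range n, q ^ j

/-- The `q`-factorial `[n]_q! = [n]_q [n-1]_q ⋯ [1]_q`. -/
def qFact {K : Type*} [Field K] (q : K) (n : ℕ) : K :=
  ∏ j ∈ Finset.range n, qInt q (j + 1)

/-- The `q`-binomial coefficient `[n]_q! / ([k]_q! [n-k]_q!)`, and `0` for `k > n`. It is used
only for `q` the variable of a field of rational functions, or its inverse, where no `q`-factorial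
vanishes. -/
def qBinom {K : Type*} [Field K] (q : K) (n k : ℕ) : K :=
  if k ≤ n then qFact q n / (qFact q k * qFact q (n - k)) else 0

/-- The `q`-multichoose coefficient `((n, k))_q`, the `q`-binomial of `n + k - 1` and `k`. -/
def qMultichoose {K : Type*} [Field K] (q : K) (n k : ℕ) : K :=
  qBinom q (n + k - 1) k

/-- The number `x' = 1 / (x - ⌊x⌋)`, whose continued fraction is that of `x` without its first
term, has a smaller denominator than `x`. -/
theorem den_inv_fract_lt (x : ℚ) (h : x.den ≠ 1) : ((Int.fract x)⁻¹).den < x.den := by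
  have hpos : 0 < Int.fract x := by
    rw [Int.fract_pos]
    intro hx
    exact h (by rw [hx]; exact Rat.den_intCast _)
  have hnum : 0 < (Int.fract x).num := Rat.num_pos.2 hpos
  have hden : (Int.fract x).den = x.den := by
    rw [← Int.self_sub_floor]
    exact Rat.sub_intCast_den x ⌊x⌋
  have hlt : (Int.fract x).num < (Int.fract x).den := by
    have h1 : Int.fract x < 1 := Int.fract_lt_one x
    exact Rat.num_lt_denom_iff.2 h1
  rw [Rat.den_inv_of_ne_zero hpos.ne', ← hden]
  omega

/-- The higher `q`-continued fraction `r^q_{i,m}(x)` of a rational number `x ≥ 1`, with the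
parameter `q` in any field. For `x = [a₁, a₂, …, aₙ]` that is not an integer, `a₁ = ⌊x⌋`, and
`x' = [a₂, …, aₙ] = 1 / (x - ⌊x⌋)`. -/
def rq {K : Type*} [Field K] (m : ℕ) (q : K) (x : ℚ) (i : ℕ) : K :=
  if i = 0 then 1
  else if _h : x.den = 1 then qMultichoose q ⌊x⌋₊ i
  else ∑ k ∈ Finset.range (i + 1), q ^ (k * ⌊x⌋₊) * qMultichoose q ⌊x⌋₊ (i - k) *
    (rq m q⁻¹ (Int.fract x)⁻¹ (m - k) / rq m q⁻¹ (Int.fract x)⁻¹ m)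
termination_by x.den
decreasing_by all_goals exact den_inv_fract_lt x _h

/-- `r^q_{i,m}(x)` as a rational function of the variable `q`. -/
noncomputable def rqRatFunc (i m : ℕ) (x : ℚ) : RatFunc ℚ :=
  rq m RatFunc.X x i

/-- The expansion of `r^q_{i,m}(x)` at `q = 0` as a formal Laurent series. -/
noncomputable def rqSeries (i m : ℕ) (x : ℚ) : LaurentSeries ℚ :=
  (rqRatFunc i m x : LaurentSeries ℚ)

/-- The series `f 0, f 1, …` stabilize to the integral Laurent series `L`: for every `N`, from some
index on, they agree with `L` in all degrees up to `N`. In particular the sequence of coefficients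
of each given degree is eventually constant, equal to the coefficient of `L`. -/
def StabilizesTo (f : ℕ → LaurentSeries ℚ) (L : LaurentSeries ℤ) : Prop :=
  ∀ N : ℤ, ∀ᶠ n in atTop, ∀ k ≤ N, (f n).coeff k = ((L.coeff k : ℤ) : ℚ)

end HigherQ

/-!
For rational `y ≥ 0` let `v(y)` be the vector of `m + 1` integer polynomials obtained from
`v(0) = (1, 0, …, 0)` by the two moves

* `y ↦ y + 1`, under which `v` is multiplied by `A D`,
* `y ↦ y / (y + 1)`, under which `v` is multiplied by `Aᵀ D`,

where `A` is the lower triangular matrix of ones and `D` is the diagonal matrix with entries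
`X ^ k`. Two facts carry the proof.

**The vector `v(y)` represents the higher `q`-continued fraction**: for `y ≥ 1`, `r^q_{i,m}(y)` is
the value of `v(y)_i / v(y)_0` at `q` (`rq_eq_div`). Indeed `(A D) ^ a` at `q` is the matrix of the
`q ^ (k a) ((a, i - k))_q`, by the `q`-Pascal rule (`aeval_iterate_lowerStep`), and reversing the
coordinates while replacing `q` by `q⁻¹` exchanges the two moves up to a power of `q`, so that it
turns `v(y)` into a multiple of `v(1 / y)` (`Represents.exists_inv`). The constant term of `v(y)_0`
is `1`; hence no denominator vanishes when `q` is transcendental, and `v(y)_i / v(y)_0` expands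
into a power series with integer coefficients.

**Both moves contract the `X`-adic distance**: each `2 × 2` minor of the matrix with columns `M v`
and `M w`, for `M` one of the two matrices, is a sum of terms `X ^ (k + l)` times the `(k, l)` minor
of `v`, `w`, and the `(0, 0)` minor is zero (`X_pow_succ_dvd_sum_minor`). An irrational `x > 0` is
never on the boundary between the two cases `y > 1` and `y < 1`, so the last `N` moves that
lead to `y` are the same for all rationals `y` near `x`, and the minors formed from two such rationals are divisible by
`X ^ N` (`exists_nhds_minor_dvd`). Therefore the expansions of `r^q_{i,m}(y)` agree up to degree
`N - 1` for all rationals `y` near `x`, and everything follows.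
-/

namespace HigherQ

open Polynomial

/-! ### Vectors of polynomials attached to nonnegative rationals -/

/-- The action on a vector of the lower triangular matrix with entries `X ^ k` for `k ≤ i`. Vectors
are indexed by `ℕ`; only the coordinates up to `m` matter. -/
noncomputable def lowerStep (v : ℕ → ℤ[X]) (i : ℕ) : ℤ[X] :=
  ∑ k ∈ Finset.range (i + 1), X ^ k * v k

/-- The action on a vector of the upper triangular matrix with entries `X ^ k` for `i ≤ k ≤ m`. -/
noncomputable def upperStep (m : ℕ) (v : ℕ → ℤ[X]) (i : ℕ) : ℤ[X] :=
  ∑ k ∈ Finset.Ico i (m + 1), X ^ k * v k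

/-- `Represents m y v` says that `v` is the vector of polynomials attached to the rational number
`y ≥ 0`. As every positive rational is either `z + 1` with `z ≥ 0` or `z / (z + 1)` with `z > 0`,
and not both, `y` determines `v`. -/
inductive Represents (m : ℕ) : ℚ → (ℕ → ℤ[X]) → Prop
  | zero : Represents m 0 (fun i => if i = 0 then 1 else 0)
  | add_one {y : ℚ} {v : ℕ → ℤ[X]} : 0 ≤ y → Represents m y v →
      Represents m (y + 1) (lowerStep v)
  | div_add_one {y : ℚ} {v : ℕ → ℤ[X]} : 0 < y → Represents m y v →
      Represents m (y / (y + 1)) (upperStep m v)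

namespace Represents

variable {m : ℕ} {y : ℚ} {v : ℕ → ℤ[X]}

theorem eq_of_zero (h : Represents m y v) (hy : y = 0) : v = fun i => if i = 0 then 1 else 0 := by
  cases h with
  | zero => rfl
  | add_one h _ => linarith
  | div_add_one h _ => exact absurd hy (by positivity)

theorem exists_of_one_le (h : Represents m y v) (hy : 1 ≤ y) :
    ∃ w, v = lowerStep w ∧ Represents m (y - 1) w := by
  cases h with
  | zero => norm_num at hy
  | add_one h hw => exact ⟨_, rfl, by simpa using hw⟩
  | div_add_one h _ =>
    rw [le_div_iff₀ (by linarith)] at hy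
    linarith

theorem exists_of_lt_one (h : Represents m y v) (h0 : 0 < y) (h1 : y < 1) :
    ∃ w, v = upperStep m w ∧ Represents m (y / (1 - y)) w := by
  cases h with
  | zero => exact absurd h0 (lt_irrefl _)
  | add_one h hw => linarith
  | @div_add_one z w h hw =>
    refine ⟨_, rfl, ?_⟩
    have : z / (z + 1) / (1 - z / (z + 1)) = z := by
      have : z + 1 ≠ 0 := by positivity
      field_simp
      ring
    rwa [this]

/-- Every `a / b` is reached by running the subtractive Euclidean algorithm on `(a, b)` backwards;
`s` bounds `a + b` and drives the induction. -/
theorem exists_of_natCast_div (m : ℕ) (s : ℕ) : ∀ a b : ℕ, a + b ≤ s → 0 < b →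
    ∃ v, Represents m ((a : ℚ) / b) v := by
  induction s with
  | zero => intro a b h hb; omega
  | succ s ih =>
    intro a b h hb
    have hbQ : (0 : ℚ) < b := by exact_mod_cast hb
    rcases Nat.eq_zero_or_pos a with rfl | ha
    · exact ⟨_, by simpa using Represents.zero⟩
    have haQ : (0 : ℚ) < a := by exact_mod_cast ha
    rcases le_or_gt b a with hab | hab
    · obtain ⟨v, hv⟩ := ih (a - b) b (by omega) hb
      refine ⟨lowerStep v, ?_⟩
      have := hv.add_one (by positivity)
      rw [Nat.cast_sub hab] at this
      convert this using 1
      field_simp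
      ring
    · obtain ⟨v, hv⟩ := ih a (b - a) (by omega) (by omega)
      refine ⟨upperStep m v, ?_⟩
      have hd : (0 : ℚ) < b - a := by
        rw [sub_pos]; exact_mod_cast hab
      rw [Nat.cast_sub hab.le] at hv
      have := hv.div_add_one (by positivity)
      convert this using 1
      have h2 : (a : ℚ) + (b - a) ≠ 0 := by linarith
      field_simp
      ring

theorem exists_of_nonneg (m : ℕ) (hy : 0 ≤ y) : ∃ v, Represents m y v := by
  obtain ⟨v, hv⟩ := exists_of_natCast_div m _ y.num.toNat y.den le_rfl y.den_pos
  refine ⟨v, ?_⟩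
  have h : ((y.num.toNat : ℕ) : ℚ) = (y.num : ℚ) := by
    have := Int.toNat_of_nonneg (Rat.num_nonneg.2 hy)
    exact_mod_cast this
  rwa [h, Rat.num_div_den] at hv

theorem coeff_zero (h : Represents m y v) : (v 0).coeff 0 = 1 := by
  induction h with
  | zero => simp
  | add_one _ _ ih => simpa [lowerStep] using ih
  | div_add_one _ _ ih =>
    rw [upperStep, Finset.sum_Ico_eq_sum_range, Polynomial.finsetSum_coeff, Nat.sub_zero,
      Finset.sum_range_succ']
    simp [ih, mul_coeff_zero]

end Represents

/-! ### Contraction of the minors -/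

/-- Multiplying two vectors by the same matrix with entries `0` or `X ^ k` in column `k` raises the
order of divisibility of their `2 × 2` minors by one. The rows are given by the finsets `s`, `t` of
their nonzero entries. -/
theorem X_pow_succ_dvd_sum_minor {N : ℕ} {v w : ℕ → ℤ[X]}
    (h : ∀ k l, X ^ N ∣ v k * w l - w k * v l) (s t : Finset ℕ) :
    X ^ (N + 1) ∣ (∑ k ∈ s, X ^ k * v k) * (∑ l ∈ t, X ^ l * w l) -
      (∑ k ∈ s, X ^ k * w k) * (∑ l ∈ t, X ^ l * v l) := by
  rw [Finset.sum_mul_sum, Finset.sum_mul_sum, ← Finset.sum_sub_distrib]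
  refine Finset.dvd_sum fun k _ => ?_
  rw [← Finset.sum_sub_distrib]
  refine Finset.dvd_sum fun l _ => ?_
  have e : X ^ k * v k * (X ^ l * w l) - X ^ k * w k * (X ^ l * v l) =
      X ^ (k + l) * (v k * w l - w k * v l) := by ring
  rw [e]
  rcases Nat.eq_zero_or_pos (k + l) with h0 | h0
  -- the only term that does not gain a factor `X` is the minor at `(0, 0)`, which is zero
  · obtain ⟨rfl, rfl⟩ : k = 0 ∧ l = 0 := by omega
    have : v 0 * w 0 - w 0 * v 0 = 0 := by ring
    simp [this]
  · rw [add_comm N 1, pow_add]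
    exact mul_dvd_mul (pow_dvd_pow _ h0) (h k l)

/-- The vectors attached to two rationals close to the same positive irrational are projectively
congruent modulo `X ^ N`. -/
theorem exists_nhds_minor_dvd (m N : ℕ) : ∀ x : ℝ, Irrational x → 0 < x →
    ∃ U ∈ 𝓝 x, ∀ y z : ℚ, (y : ℝ) ∈ U → (z : ℝ) ∈ U → ∀ v w, Represents m y v →
      Represents m z w → ∀ k l, X ^ N ∣ v k * w l - w k * v l := by
  induction N with
  | zero => exact fun x _ _ => ⟨Set.univ, univ_mem, by simp⟩
  | succ N ih =>
    intro x hx hx0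
    rcases lt_or_gt_of_ne hx.ne_one with h1 | h1
    · have hne : 1 - x ≠ 0 := by linarith
      have hirr : Irrational (x / (1 - x)) := by
        rintro ⟨r, hr⟩
        rw [eq_div_iff hne] at hr
        have hr0 : (1 + (r : ℝ)) ≠ 0 := by
          intro h0
          have : (r : ℝ) = -1 := by linarith
          rw [this] at hr
          linarith
        refine hx ⟨r / (1 + r), ?_⟩
        push_cast
        rw [div_eq_iff hr0]
        linarith
      obtain ⟨U, hU, hUd⟩ := ih _ hirr (div_pos hx0 (by linarith))
      have hc : ContinuousAt (fun t : ℝ => t / (1 - t)) x :=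
        continuousAt_id.div (continuousAt_const.sub continuousAt_id) hne
      refine ⟨_, inter_mem (hc hU) (Ioo_mem_nhds hx0 h1), ?_⟩
      rintro y z ⟨hyU, hy0, hy1⟩ ⟨hzU, hz0, hz1⟩ v w hv hw
      obtain ⟨v, rfl, hv'⟩ := hv.exists_of_lt_one (by exact_mod_cast hy0) (by exact_mod_cast hy1)
      obtain ⟨w, rfl, hw'⟩ := hw.exists_of_lt_one (by exact_mod_cast hz0) (by exact_mod_cast hz1)
      have hyU' : ((y / (1 - y) : ℚ) : ℝ) ∈ U := by push_cast; exact hyU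
      have hzU' : ((z / (1 - z) : ℚ) : ℝ) ∈ U := by push_cast; exact hzU
      exact fun k l => X_pow_succ_dvd_sum_minor (hUd _ _ hyU' hzU' v w hv' hw') _ _
    · have hirr : Irrational (x - 1) := by simpa using hx.sub_ratCast 1
      obtain ⟨U, hU, hUd⟩ := ih _ hirr (by linarith)
      have hc : ContinuousAt (fun t : ℝ => t - 1) x := by fun_prop
      refine ⟨_, inter_mem (hc hU) (Ioi_mem_nhds h1), ?_⟩
      rintro y z ⟨hyU, hy1⟩ ⟨hzU, hz1⟩ v w hv hw
      obtain ⟨v, rfl, hv'⟩ := hv.exists_of_one_le (by exact_mod_cast (Set.mem_Ioi.1 hy1).le)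
      obtain ⟨w, rfl, hw'⟩ := hw.exists_of_one_le (by exact_mod_cast (Set.mem_Ioi.1 hz1).le)
      have hyU' : ((y - 1 : ℚ) : ℝ) ∈ U := by push_cast; exact hyU
      have hzU' : ((z - 1 : ℚ) : ℝ) ∈ U := by push_cast; exact hzU
      exact fun k l => X_pow_succ_dvd_sum_minor (hUd _ _ hyU' hzU' v w hv' hw') _ _

/-! ### The `q`-multichoose matrix -/

section Evaluation

variable {K : Type*} [Field K] {q : K}

theorem aeval_ne_zero (hq : Transcendental ℤ q) {p : ℤ[X]} (hp : p.coeff 0 = 1) :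
    aeval q p ≠ 0 := by
  intro h
  have := (transcendental_iff.1 hq) p h
  simp [this] at hp

theorem qInt_add (q : K) (a b : ℕ) : qInt q (a + b) = qInt q a + q ^ a * qInt q b := by
  simp [qInt, Finset.sum_range_add, Finset.mul_sum, pow_add]

theorem qInt_ne_zero (hq : Transcendental ℤ q) (n : ℕ) : qInt q (n + 1) ≠ 0 := by
  have h := aeval_ne_zero hq (p := ∑ j ∈ Finset.range (n + 1), X ^ j)
    (by simp [Finset.sum_range_succ'])
  simpa [qInt] using h

theorem qFact_succ (q : K) (n : ℕ) : qFact q (n + 1) = qFact q n * qInt q (n + 1) :=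
  Finset.prod_range_succ _ _

theorem qFact_ne_zero (hq : Transcendental ℤ q) (n : ℕ) : qFact q n ≠ 0 :=
  Finset.prod_ne_zero_iff.2 fun j _ => qInt_ne_zero hq j

theorem qMultichoose_zero_right (hq : Transcendental ℤ q) (n : ℕ) : qMultichoose q n 0 = 1 := by
  have h0 : qFact q 0 = 1 := rfl
  simp [qMultichoose, qBinom, h0, qFact_ne_zero hq]

theorem qMultichoose_zero_succ (q : K) (n : ℕ) : qMultichoose q 0 (n + 1) = 0 := by
  simp [qMultichoose, qBinom]

/-- The `q`-Pascal rule. -/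
theorem qMultichoose_succ_succ (hq : Transcendental ℤ q) (a n : ℕ) :
    qMultichoose q (a + 1) (n + 1) =
      qMultichoose q (a + 1) n + q ^ (n + 1) * qMultichoose q a (n + 1) := by
  have h0 : qFact q 0 = 1 := rfl
  -- for `a = 0` the last term is the `q`-binomial of `n` and `n + 1`, which is `0`
  rcases a with _ | b
  · simp [qMultichoose, qBinom, h0, qFact_ne_zero hq]
  · have e1 : b + 1 + 1 + (n + 1) - 1 = b + n + 1 + 1 := by omega
    have e2 : b + 1 + 1 + n - 1 = b + n + 1 := by omega
    have e3 : b + 1 + (n + 1) - 1 = b + n + 1 := by omega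
    have e4 : b + n + 1 + 1 - (n + 1) = b + 1 := by omega
    have e5 : b + n + 1 - n = b + 1 := by omega
    have e6 : b + n + 1 - (n + 1) = b := by omega
    have l1 : n + 1 ≤ b + n + 1 + 1 := by omega
    have l2 : n ≤ b + n + 1 := by omega
    have l3 : n + 1 ≤ b + n + 1 := by omega
    have hb := qFact_ne_zero hq b
    have hn := qFact_ne_zero hq n
    have hb1 := qInt_ne_zero hq b
    have hn1 := qInt_ne_zero hq n
    have hadd : qInt q (b + n + 1 + 1) = qInt q (n + 1) + q ^ (n + 1) * qInt q (b + 1) := by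
      rw [← qInt_add]
      congr 1
      omega
    simp only [qMultichoose, qBinom, e1, e2, e3, e4, e5, e6, l1, l2, l3, if_true]
    rw [qFact_succ q (b + n + 1), qFact_succ q n, qFact_succ q b, hadd]
    field_simp

theorem sum_qMultichoose (hq : Transcendental ℤ q) (a n : ℕ) :
    ∑ s ∈ Finset.range (n + 1), q ^ s * qMultichoose q a s = qMultichoose q (a + 1) n := by
  induction n with
  | zero => simp [qMultichoose_zero_right hq]
  | succ n ih => rw [Finset.sum_range_succ, ih, qMultichoose_succ_succ hq]

theorem aeval_iterate_lowerStep (hq : Transcendental ℤ q) (v : ℕ → ℤ[X]) (a i : ℕ) :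
    aeval q (lowerStep^[a] v i) = ∑ k ∈ Finset.range (i + 1),
      q ^ (k * a) * qMultichoose q a (i - k) * aeval q (v k) := by
  induction a generalizing i with
  | zero =>
    rw [Finset.sum_range_succ, Finset.sum_eq_zero]
    · simp [qMultichoose_zero_right hq]
    · intro k hk
      obtain ⟨d, hd⟩ : ∃ d, i - k = d + 1 := ⟨i - k - 1, by rw [Finset.mem_range] at hk; omega⟩
      simp [hd, qMultichoose_zero_succ]
  | succ a ih =>
    rw [Function.iterate_succ_apply']
    simp only [lowerStep, map_sum, map_mul, map_pow, aeval_X, ih, Finset.mul_sum]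
    rw [Finset.sum_comm' (t' := Finset.range (i + 1)) (s' := fun k => Finset.Ico k (i + 1))
      (by intro j k; simp only [Finset.mem_range, Finset.mem_Ico]; omega)]
    refine Finset.sum_congr rfl fun k hk => ?_
    rw [Finset.sum_Ico_eq_sum_range, Nat.sub_add_comm (Nat.lt_succ_iff.1 (Finset.mem_range.1 hk)),
      ← sum_qMultichoose hq, Finset.mul_sum, Finset.sum_mul]
    refine Finset.sum_congr rfl fun s _ => ?_
    rw [Nat.add_sub_cancel_left]
    ring

/-! ### Reciprocals and the recursion for `r^q_{i,m}` -/

/-- Replacing `q` by `q⁻¹` and reversing the order of the coordinates turns a row with entries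
`X ^ k` into the reversed row of the same kind, up to the factor `q⁻¹ ^ m`. In particular it
exchanges `lowerStep` and `upperStep m`. -/
theorem aeval_inv_sum_reverse (hq : q ≠ 0) {m : ℕ} {v w : ℕ → ℤ[X]} {c : K}
    (h : ∀ i ≤ m, aeval q⁻¹ (v (m - i)) = c * aeval q (w i)) {s t : Finset ℕ}
    (hs : ∀ k ∈ s, k ≤ m ∧ m - k ∈ t) (ht : ∀ k ∈ t, k ≤ m ∧ m - k ∈ s) :
    aeval q⁻¹ (∑ k ∈ s, X ^ k * v k) = (q⁻¹ ^ m * c) * aeval q (∑ k ∈ t, X ^ k * w k) := by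
  simp only [map_sum, map_mul, map_pow, aeval_X, Finset.mul_sum]
  refine Finset.sum_bij' (fun k _ => m - k) (fun k _ => m - k) (fun k hk => (hs k hk).2)
    (fun k hk => (ht k hk).2) (fun k hk => Nat.sub_sub_self (hs k hk).1)
    (fun k hk => Nat.sub_sub_self (ht k hk).1) fun k hk => ?_
  have hk' := (hs k hk).1
  have hv := h (m - k) (Nat.sub_le _ _)
  rw [Nat.sub_sub_self hk'] at hv
  have e : q⁻¹ ^ m = q⁻¹ ^ k * q⁻¹ ^ (m - k) := by rw [← pow_add, Nat.add_sub_cancel' hk']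
  rw [hv, e, inv_pow q (m - k)]
  field_simp

/-- Up to a nonzero factor, the vector attached to `y⁻¹` at `q` is the reversed vector attached to
`y` at `q⁻¹`. -/
theorem Represents.exists_inv (hq : Transcendental ℤ q) {m : ℕ} {y : ℚ} {v : ℕ → ℤ[X]}
    (hv : Represents m y v) (hy : 0 < y) :
    ∃ w, Represents m y⁻¹ w ∧ ∃ c : K, c ≠ 0 ∧
      ∀ i ≤ m, aeval q⁻¹ (v (m - i)) = c * aeval q (w i) := by
  have hq0 : q ≠ 0 := by
    rintro rfl
    exact hq isAlgebraic_zero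
  induction hv with
  | zero => exact absurd hy (lt_irrefl _)
  | @add_one y v h0 hv ih =>
    rcases h0.eq_or_lt with h0 | h0
    -- `y + 1 = 1` is its own inverse, and its vector is constant
    · subst h0
      rw [hv.eq_of_zero rfl]
      refine ⟨_, by simpa using Represents.zero.add_one le_rfl, 1, one_ne_zero, fun i _ => ?_⟩
      simp [lowerStep]
    · obtain ⟨w, hw, c, hc, h⟩ := ih h0
      refine ⟨upperStep m w, ?_, q⁻¹ ^ m * c, by positivity,
        fun i hi => aeval_inv_sum_reverse hq0 h
          (by intro k; simp only [Finset.mem_range, Finset.mem_Ico]; omega)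
          (by intro k; simp only [Finset.mem_range, Finset.mem_Ico]; omega)⟩
      convert hw.div_add_one (by positivity) using 1
      field_simp
      ring
  | @div_add_one y v h0 hv ih =>
    obtain ⟨w, hw, c, hc, h⟩ := ih h0
    refine ⟨lowerStep w, ?_, q⁻¹ ^ m * c, by positivity,
      fun i hi => aeval_inv_sum_reverse hq0 h
          (by intro k; simp only [Finset.mem_range, Finset.mem_Ico]; omega)
          (by intro k; simp only [Finset.mem_range, Finset.mem_Ico]; omega)⟩
    convert hw.add_one (by positivity) using 1
    field_simp
    ring

theorem Represents.exists_iterate {m : ℕ} (a : ℕ) {y : ℚ} {v : ℕ → ℤ[X]}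
    (hv : Represents m y v) (hy : (a : ℚ) ≤ y) :
    ∃ w, v = lowerStep^[a] w ∧ Represents m (y - a) w := by
  induction a generalizing y v with
  | zero => exact ⟨v, rfl, by simpa using hv⟩
  | succ a ih =>
    push_cast at hy
    have ha : (0 : ℚ) ≤ a := a.cast_nonneg
    obtain ⟨u, rfl, hu⟩ := hv.exists_of_one_le (by linarith)
    obtain ⟨w, rfl, hw⟩ := ih hu (by linarith)
    refine ⟨w, (Function.iterate_succ_apply' _ _ _).symm, ?_⟩
    convert hw using 1
    push_cast
    ring

theorem lowerStep_iterate_zero (v : ℕ → ℤ[X]) (a : ℕ) : lowerStep^[a] v 0 = v 0 := by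
  induction a with
  | zero => rfl
  | succ a ih => rw [Function.iterate_succ_apply']; simpa [lowerStep] using ih

theorem transcendental_inv (hq : Transcendental ℤ q) : Transcendental ℤ q⁻¹ := fun h =>
  hq (IsAlgebraic.inv_iff.1 h)

end Evaluation

/-- For `y ≥ 1` the vector attached to `y`, evaluated at `q` and divided by its coordinate `0`, is
`(r^q_{i,m}(y))_i`. The recursion alternates between `q` and `q⁻¹`, hence the arbitrary
transcendental `q`; the induction is on the denominator `d` of `y`. -/
theorem rq_eq_div {m : ℕ} (d : ℕ) : ∀ {K : Type*} [Field K] {q : K}, Transcendental ℤ q →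
    ∀ {y : ℚ}, y.den = d → 1 ≤ y → ∀ {v}, Represents m y v → ∀ {i}, i ≤ m →
      rq m q y i = aeval q (v i) / aeval q (v 0) := by
  induction d using Nat.strong_induction_on with
  | _ d ih =>
  intro K _ q hq y hd hy v hv i hi
  have hv0 := aeval_ne_zero hq hv.coeff_zero
  rw [rq]
  split_ifs with h0 h1
  · rw [h0, div_self hv0]
  · have hfl : (⌊y⌋₊ : ℚ) = y := by
      have hn : ((y.num.toNat : ℕ) : ℚ) = y := by
        have := Int.toNat_of_nonneg (Rat.num_nonneg.2 (zero_le_one.trans hy))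
        rw [← Int.cast_natCast, this, Rat.coe_int_num_of_den_eq_one h1]
      rw [← hn, Nat.floor_natCast]
    obtain ⟨w, rfl, hw⟩ := hv.exists_iterate ⌊y⌋₊ hfl.le
    obtain rfl := hw.eq_of_zero (by linarith)
    rw [aeval_iterate_lowerStep hq, lowerStep_iterate_zero, Finset.sum_range_succ']
    simp
  · have hy0 : 0 ≤ y := zero_le_one.trans hy
    have hfr : y - (⌊y⌋₊ : ℕ) = Int.fract y := by
      rw [← Int.self_sub_floor, ← natCast_floor_eq_intCast_floor hy0]
    have hpos : 0 < Int.fract y := by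
      rw [Int.fract_pos]
      intro hx
      exact h1 (by rw [hx]; exact Rat.den_intCast _)
    obtain ⟨w, rfl, hw⟩ := hv.exists_iterate ⌊y⌋₊ (Nat.floor_le hy0)
    rw [hfr] at hw
    -- the vector of the fractional part at `q` is, up to a factor, the reversed vector of its
    -- inverse at `q⁻¹`, which the induction hypothesis identifies
    obtain ⟨u, hu, c, hc, h⟩ := hw.exists_inv (transcendental_inv hq) hpos
    rw [inv_inv] at h
    have hrec : ∀ j ≤ m, rq m q⁻¹ (Int.fract y)⁻¹ j = aeval q⁻¹ (u j) / aeval q⁻¹ (u 0) :=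
      fun j hj => ih _ (hd ▸ den_inv_fract_lt y h1) (transcendental_inv hq) rfl
        ((one_le_inv₀ hpos).2 (Int.fract_lt_one y).le) hu hj
    have hu0 := aeval_ne_zero (transcendental_inv hq) hu.coeff_zero
    rw [aeval_iterate_lowerStep hq, lowerStep_iterate_zero, Finset.sum_div]
    refine Finset.sum_congr rfl fun k hk => ?_
    have hkm : k ≤ m := by simp at hk; omega
    rw [hrec _ (Nat.sub_le _ _), hrec _ le_rfl]
    have hk' := h (m - k) (Nat.sub_le _ _)
    have hm' := h m le_rfl
    rw [Nat.sub_sub_self hkm] at hk'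
    rw [Nat.sub_self] at hm'
    rw [hk', hm', div_div_div_cancel_right₀ hu0, mul_div_assoc, mul_div_mul_left _ _ hc]

/-! ### Expansion at `q = 0` -/

theorem isUnit_coe_powerSeries {p : ℤ[X]} (h : p.coeff 0 = 1) : IsUnit (p : PowerSeries ℤ) := by
  simp [PowerSeries.isUnit_iff_constantCoeff, h]

/-- The quotients `S = A / B` and `T = C / D` agree below degree `N` if `X ^ N ∣ A D - C B`. -/
theorem coeff_eq_of_minor_dvd {A B C D S T : PowerSeries ℤ} {N : ℕ}
    (hB : IsUnit B) (hD : IsUnit D) (hS : S * B = A) (hT : T * D = C)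
    (h : PowerSeries.X ^ N ∣ A * D - C * B) {k : ℕ} (hk : k < N) :
    PowerSeries.coeff k S = PowerSeries.coeff k T := by
  have e : A * D - C * B = (S - T) * (B * D) := by rw [← hS, ← hT]; ring
  rw [e, (hB.mul hD).dvd_mul_right, PowerSeries.X_pow_dvd_iff] at h
  simpa [sub_eq_zero] using h k hk

theorem transcendental_int_of_rat {K : Type*} [Field K] {_ : Algebra ℚ K} {q : K}
    (hq : Transcendental ℚ q) : Transcendental ℤ q :=
  hq.restrictScalars (Int.cast_injective (α := ℚ))

/-- Under compatible ring homomorphisms to a field, `r^q_{i,m}(y)` and the integral power series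
`v_i / v_0` have the same image. -/
theorem map_rq_eq_map_powerSeries {K F : Type*} [Field K] [Field F] {q : K}
    (hq : Transcendental ℤ q) (φ : K →+* F) (ψ : PowerSeries ℤ →+* F)
    (hψ : ψ PowerSeries.X = φ q) {i m : ℕ} (hi : i ≤ m) {y : ℚ} (hy : 1 ≤ y) {v : ℕ → ℤ[X]}
    (hv : Represents m y v) {S : PowerSeries ℤ}
    (hS : S * (v 0 : PowerSeries ℤ) = (v i : PowerSeries ℤ)) :
    φ (rq m q y i) = ψ S := by
  have key : ∀ p : ℤ[X], φ (aeval q p) = ψ (p : PowerSeries ℤ) := fun p => by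
    have : φ.comp (aeval q).toRingHom = ψ.comp coeToPowerSeries.ringHom :=
      Polynomial.ringHom_ext' (RingHom.ext_int _ _) (by simp [hψ])
    exact RingHom.congr_fun this p
  have h0 : ψ (v 0 : PowerSeries ℤ) ≠ 0 := by
    rw [← key]
    exact (map_ne_zero φ).2 (aeval_ne_zero hq hv.coeff_zero)
  rw [rq_eq_div _ hq rfl hy hv hi, map_div₀, key, key, div_eq_iff h0, ← map_mul, hS]

theorem rqSeries_eq_powerSeries {i m : ℕ} (hi : i ≤ m) {y : ℚ} (hy : 1 ≤ y) {v : ℕ → ℤ[X]}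
    (hv : Represents m y v) {S : PowerSeries ℤ}
    (hS : S * (v 0 : PowerSeries ℤ) = (v i : PowerSeries ℤ)) :
    rqSeries i m y = HahnSeries.ofPowerSeries ℤ ℚ (PowerSeries.map (Int.castRingHom ℚ) S) := by
  unfold rqSeries rqRatFunc
  exact map_rq_eq_map_powerSeries (transcendental_int_of_rat RatFunc.transcendental_X) _
    ((HahnSeries.ofPowerSeries ℤ ℚ).comp (PowerSeries.map (Int.castRingHom ℚ)))
    (by simp) hi hy hv hS

end HigherQ

theorem mainTheorem3 (i m : ℕ) (hi : i ≤ m) (x : ℝ) (hx : Irrational x) (hx1 : 1 < x) :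
    ∃! L : LaurentSeries ℤ,
      (∀ k < 0, L.coeff k = 0) ∧
      HigherQ.StabilizesTo (fun n => HigherQ.rqSeries i m (x.convergent n)) L ∧
      ∀ y : ℕ → ℚ, Tendsto (fun n => (y n : ℝ)) atTop (𝓝 x) →
        HigherQ.StabilizesTo (fun n => HigherQ.rqSeries i m (y n)) L := by
  have hconv : Tendsto (fun n => (x.convergent n : ℝ)) atTop (𝓝 x) := by
    simpa only [← Real.convs_eq_convergent] using GenContFract.of_convergence x
  have hexp : ∀ y : ℚ, 1 ≤ y → ∃ S : PowerSeries ℤ, ∃ v, HigherQ.Represents m y v ∧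
      S * (v 0 : PowerSeries ℤ) = (v i : PowerSeries ℤ) := fun y hy => by
    obtain ⟨v, hv⟩ := HigherQ.Represents.exists_of_nonneg m (zero_le_one.trans hy)
    obtain ⟨S, hS⟩ := (HigherQ.isUnit_coe_powerSeries hv.coeff_zero).dvd
      (a := (v i : PowerSeries ℤ))
    exact ⟨S, v, hv, by rw [mul_comm, ← hS]⟩
  -- `S y` is the expansion of `r^q_{i,m}(y)` as an integral power series
  choose! S v hv hS using hexp
  have hloc : ∀ N : ℕ, ∃ U ∈ 𝓝 x, (∀ y : ℚ, (y : ℝ) ∈ U → 1 ≤ y) ∧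
      ∀ y z : ℚ, (y : ℝ) ∈ U → (z : ℝ) ∈ U →
        ∀ k < N, PowerSeries.coeff k (S y) = PowerSeries.coeff k (S z) := fun N => by
    obtain ⟨U, hU, h⟩ := HigherQ.exists_nhds_minor_dvd m N x hx (zero_lt_one.trans hx1)
    have hone : ∀ y : ℚ, (y : ℝ) ∈ U ∩ Set.Ioi 1 → 1 ≤ y := fun y hy => by
      exact_mod_cast (Set.mem_Ioi.1 hy.2).le
    refine ⟨_, inter_mem hU (Ioi_mem_nhds hx1), hone, fun y z hy hz k hk => ?_⟩
    have hyv := hv y (hone y hy)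
    have hzv := hv z (hone z hz)
    refine HigherQ.coeff_eq_of_minor_dvd (HigherQ.isUnit_coe_powerSeries hyv.coeff_zero)
      (HigherQ.isUnit_coe_powerSeries hzv.coeff_zero) (hS y (hone y hy)) (hS z (hone z hz)) ?_ hk
    have := map_dvd (Polynomial.coeToPowerSeries.ringHom (R := ℤ))
      (h y z hy.1 hz.1 _ _ hyv hzv i 0)
    simpa using this
  choose U hU hone hagree using hloc
  have hrat : ∀ N, ∃ r : ℚ, (r : ℝ) ∈ U N := fun N => by
    have := (Rat.denseRange_cast (𝕜 := ℝ)).inter_nhds_nonempty (hU N)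
    obtain ⟨_, ⟨r, rfl⟩, hr⟩ := this
    exact ⟨r, hr⟩
  choose r hr using hrat
  -- the coefficient of degree `k` is constant on the rationals in `U (k + 1)`
  let L : LaurentSeries ℤ := HahnSeries.ofPowerSeries ℤ ℤ
    (PowerSeries.mk fun k => PowerSeries.coeff k (S (r (k + 1))))
  have hstab : ∀ y : ℕ → ℚ, Tendsto (fun n => (y n : ℝ)) atTop (𝓝 x) →
      HigherQ.StabilizesTo (fun n => HigherQ.rqSeries i m (y n)) L := fun y hy N => by
    have hev : ∀ᶠ n in atTop, ∀ k ∈ Finset.range (N.toNat + 1), (y n : ℝ) ∈ U (k + 1) :=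
      (Finset.eventually_all _).2 fun k _ => hy (hU (k + 1))
    filter_upwards [hev] with n hn k hk
    have h1 : 1 ≤ y n := hone _ _ (hn 0 (by simp))
    rw [HigherQ.rqSeries_eq_powerSeries hi h1 (hv _ h1) (hS _ h1), PowerSeries.coeff_coe,
      PowerSeries.coeff_coe]
    split_ifs with hneg
    · simp
    · have := hagree _ (y n) (r (k.natAbs + 1)) (hn k.natAbs (by simp; omega)) (hr _) k.natAbs
        (Nat.lt_succ_self _)
      simp [this]
  refine ⟨L, ⟨fun k hk => ?_, hstab _ hconv, hstab⟩, fun L' hL' => ?_⟩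
  · rw [PowerSeries.coeff_coe, if_pos hk]
  · ext k
    obtain ⟨n, h, h'⟩ := ((hL'.2.1 k).and (hstab _ hconv k)).exists
    exact_mod_cast (h k le_rfl).symm.trans (h' k le_rfl)
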